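/- For an integer $d$ let $T_d(x)\in\mathbb{Z}[x]$ denote the normalized Chebyshev polynomial, given by $T_0(x)=2$, $T_1(x)=x$ and $T_{d+1}(x)=x\,T_d(x)-T_{d-1}(x)$. Let $d$ be an integer and let $b<-1$ be an integer such that both of the following hold: (i) $b$ and $1+4b$ are squarefree; (ii) for every prime $p$ dividing $d$ but not dividing $b$, one has $T_p\left(2+\frac1b\right)\not\equiv 2+\frac1b \pmod{p^2}$, the congruence being taken in the localization $\mathbb{Z}_{(p)}$ of $\mathbb{Z}$ at $p$. Then, for every root $\alpha\in\mathbb{C}$ of $T_d(x)-\left(2+\frac1b\right)$, the number field $K=\mathbb{Q}(\alpha)$ is monogenic, i.e. its ring of integers satisfies $\mathcal{O}_K=\mathbb{Z}[\beta]$ for some $\beta\in\mathcal{O}_K$, and totally real. -/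

import Mathlib

/-- A field `K` (in practice a number field) is monogenic if its ring of integers is
generated, as a ring over `ℤ`, by a single element: `𝓞 K = ℤ[β]` for some `β ∈ 𝓞 K`. -/
def IsMonogenicField (K : Type*) [Field K] : Prop :=
  ∃ β : NumberField.RingOfIntegers K, Algebra.adjoin ℤ {β} = ⊤

/-- Congruence `x ≡ y mod p ^ k` of rational numbers, in the sense of the localization `ℤ_(p)`
of `ℤ` at the prime `p`: the difference `x - y` lies in `p ^ k ℤ_(p)`, where `ℤ_(p)` is the set of
rational numbers whose reduced denominator is not divisible by `p`. -/
def RatCongrModPow (p k : ℕ) (x y : ℚ) : Prop :=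
  ∃ z : ℚ, ¬ p ∣ z.den ∧ x - y = (p : ℚ) ^ k * z

open Polynomial

/-! ### Chebyshev identities: derivative, degree, reduction modulo `p`. -/

section Chebyshev

/-! Write `t = 2 + 1/b` and `y = (α - 2)⁻¹`. Since `T_d(2) = 2`, reversing `T_d(X + 2) - 2` turns
`T_d(α) = t` into `y ^ d = b * G(y)` with `G(0) = 1` (for `d > 0`, which suffices as `T_{-d} =
T_d`). So `y` is integral, and it remains to see that `ℤ[y]` is Dedekind: the maximal ideal `𝔪` of
each localization above a prime `p` must be principal.

Always `𝔪 = (p, g)` for a single `g`, so by Nakayama `p ∈ 𝔪 ^ 2` suffices. If `p ∣ b`, the equation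
is of Eisenstein type. If `p ∤ b`, then `y` is a unit and `α` may replace it. For `p ∣ d`, `T_d =
T_p ∘ T_{d/p}` and the non-congruence modulo `p ^ 2` gives `p ∈ 𝔪 ^ 2`. For `p ∤ d`, either
`T_d'(α)` is a unit and `𝔪 = (p)`, or `(X ^ 2 - 4) T_d' ^ 2 = d ^ 2 (T_d ^ 2 - 4)` puts the
squarefree number `1 + 4b` in `𝔪 ^ 2`.

Total reality: `t ∈ [-2, 2]`, and `T_d(2 cos θ) = 2 cos dθ`. -/

theorem Polynomial.Chebyshev.derivative_C_eq_S (R : Type*) [CommRing R] (n : ℤ) :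
    derivative (Chebyshev.C R n) = n * Chebyshev.S R (n - 1) := by
  induction n using Polynomial.Chebyshev.induct' with
  | zero => simp
  | one => simp
  | add_two n ih1 ih2 =>
    have h1 := Chebyshev.C_eq_S_sub_X_mul_S R (n + 1)
    have h2 := Chebyshev.S_sub_one R ((n : ℤ) + 1)
    have h3 := Chebyshev.S_sub_one R (n : ℤ)
    rw [Chebyshev.C_add_two, derivative_sub, derivative_mul, ih1, ih2]
    rw [show (n : ℤ) + 2 - 1 = n + 1 by ring]
    simp only [add_sub_cancel_right, derivative_X] at *
    push_cast
    linear_combination h1 - ((n : ℕ) : R[X]) * h3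
  | neg n ih =>
    have h := Chebyshev.S_neg_sub_one R n
    rw [Chebyshev.C_neg, ih, h]
    push_cast
    ring

theorem Polynomial.Chebyshev.X_sq_sub_four_mul_derivative_C_sq (R : Type*) [CommRing R] (n : ℤ) :
    (X ^ 2 - 4) * derivative (Chebyshev.C R n) ^ 2 =
      (n : R[X]) ^ 2 * (Chebyshev.C R n ^ 2 - 4) := by
  have h1 := Chebyshev.C_eq_S_sub_X_mul_S R n
  have h2 := Chebyshev.S_sq_add_S_sq R (n - 1)
  rw [sub_add_cancel] at h2
  rw [Chebyshev.derivative_C_eq_S, h1]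
  linear_combination -4 * (n : R[X]) ^ 2 * h2

theorem Polynomial.Chebyshev.monic_C_natDegree_C (R : Type*) [CommRing R] [Nontrivial R] (n : ℕ) :
    (Chebyshev.C R (n + 1 : ℕ)).Monic ∧ (Chebyshev.C R (n + 1 : ℕ)).natDegree = n + 1 := by
  induction n using Nat.strong_induction_on with
  | _ n ih =>
    match n with
    | 0 => simp
    | 1 =>
      have h : (Chebyshev.C R ((1 + 1 : ℕ) : ℤ)) = X ^ 2 - Polynomial.C 2 := by
        rw [map_ofNat]; exact Chebyshev.C_two R
      rw [h]
      exact ⟨monic_X_pow_sub_C _ two_ne_zero, natDegree_X_pow_sub_C⟩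
    | k + 2 =>
      obtain ⟨-, d0⟩ := ih k (by omega)
      obtain ⟨m1, d1⟩ := ih (k + 1) (by omega)
      have h : Chebyshev.C R ((k + 2 + 1 : ℕ) : ℤ) =
          X * Chebyshev.C R ((k + 1 + 1 : ℕ) : ℤ) - Chebyshev.C R ((k + 1 : ℕ) : ℤ) :=
        Chebyshev.C_add_two R ((k + 1 : ℕ) : ℤ)
      rw [h]
      generalize Chebyshev.C R ((k + 1 + 1 : ℕ) : ℤ) = f at *
      generalize Chebyshev.C R ((k + 1 : ℕ) : ℤ) = g at *
      have dX : (X * f).natDegree = k + 2 + 1 := by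
        rw [monic_X.natDegree_mul m1, d1, natDegree_X]; ring
      have hlt : g.natDegree < (X * f).natDegree := by omega
      exact ⟨(monic_X.mul m1).sub_of_left (degree_lt_degree hlt),
        by rw [natDegree_sub_eq_left_of_natDegree_lt hlt, dX]⟩

/-- Modulo `p` this is the Frobenius property of Dickson polynomials. -/
theorem Polynomial.Chebyshev.exists_C_prime_eq (p : ℕ) [Fact p.Prime] :
    ∃ s : ℤ[X], Chebyshev.C ℤ p = X ^ p + (p : ℤ[X]) * s := by
  have h : (Chebyshev.C ℤ p - X ^ p).map (Int.castRingHom (ZMod p)) = 0 := by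
    rw [Polynomial.map_sub, Chebyshev.map_C, ← dickson_one_one_eq_chebyshev_C,
      dickson_one_one_zmod_p]
    simp
  have h2 : Polynomial.C (p : ℤ) ∣ Chebyshev.C ℤ p - X ^ p := by
    rw [C_dvd_iff_dvd_coeff]
    intro i
    rw [← ZMod.intCast_zmod_eq_zero_iff_dvd, ← eq_intCast (Int.castRingHom (ZMod p)), ← coeff_map,
      h, coeff_zero]
  obtain ⟨s, hs⟩ := h2
  exact ⟨s, by rw [← sub_eq_iff_eq_add', hs]; simp⟩

end Chebyshev

/-! ### Principality of the maximal ideal of a local ring generated by one element. -/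

section LocalRing

open IsLocalRing

/-- `(ZMod p)[X]` is a principal ideal ring: `G` lifts a generator of the image there of the
preimage of `𝔪` in `ℤ[X]`. -/
theorem exists_maximalIdeal_eq_span_pair {A : Type*} [CommRing A] [IsLocalRing A] {p : ℕ}
    [Fact p.Prime] (w : A) (hp : (p : A) ∈ maximalIdeal A)
    (hw : ∀ z ∈ maximalIdeal A, ∃ u : A, IsUnit u ∧ ∃ Q : ℤ[X], u * z = aeval w Q) :
    ∃ G : ℤ[X], maximalIdeal A = Ideal.span {(p : A), aeval w G} ∧
      ∀ Q : ℤ[X], aeval w Q ∈ maximalIdeal A → ∃ H R : ℤ[X], Q = G * H + (p : ℤ[X]) * R := by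
  set π : ℤ[X] →+* (ZMod p)[X] := mapRingHom (Int.castRingHom (ZMod p)) with hπ
  have hπs : Function.Surjective π := map_surjective _ (ZMod.ringHom_surjective _)
  set J : Ideal ℤ[X] := (maximalIdeal A).comap (aeval w : ℤ[X] →ₐ[ℤ] A) with hJ
  obtain ⟨g, hg⟩ := (IsPrincipalIdealRing.principal (J.map π)).principal
  have hgm : g ∈ J.map π := hg ▸ Submodule.mem_span_singleton_self g
  obtain ⟨G, hGJ, rfl⟩ := (Ideal.mem_map_iff_of_surjective π hπs).1 hgm
  have key : ∀ Q : ℤ[X], aeval w Q ∈ maximalIdeal A →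
      ∃ H R : ℤ[X], Q = G * H + (p : ℤ[X]) * R := by
    intro Q hQ
    have : π Q ∈ J.map π := Ideal.mem_map_of_mem π (show Q ∈ J from hQ)
    rw [hg] at this
    obtain ⟨h, hh⟩ := Ideal.mem_span_singleton.1 this
    obtain ⟨H, rfl⟩ := hπs h
    have h0 : π (Q - G * H) = 0 := by rw [map_sub, map_mul, hh, sub_self]
    have h2 : Polynomial.C (p : ℤ) ∣ Q - G * H := by
      rw [C_dvd_iff_dvd_coeff]
      intro i
      rw [← ZMod.intCast_zmod_eq_zero_iff_dvd, ← eq_intCast (Int.castRingHom (ZMod p)),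
        ← coeff_map]
      exact (congrArg (fun f => coeff f i) h0).trans (coeff_zero i)
    obtain ⟨R, hR⟩ := h2
    exact ⟨H, R, by rw [← sub_eq_iff_eq_add', hR]; simp⟩
  refine ⟨G, le_antisymm (fun z hz => ?_) ?_, key⟩
  · obtain ⟨u, hu, Q, hQ⟩ := hw z hz
    obtain ⟨H, R, rfl⟩ := key Q (hQ ▸ Ideal.mul_mem_left _ u hz)
    rw [← Ideal.unit_mul_mem_iff_mem _ hu, hQ, Ideal.mem_span_pair]
    exact ⟨aeval w R, aeval w H, by simp; ring⟩
  · rw [Ideal.span_le]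
    rintro _ (rfl | rfl)
    · exact hp
    · exact hGJ

/-- A simple root of an integral polynomial generates an extension unramified over `ℤ`. -/
theorem maximalIdeal_isPrincipal_of_derivative_notMem {A : Type*} [CommRing A] [IsLocalRing A]
    {p : ℕ} [Fact p.Prime] (w : A) (hp : (p : A) ∈ maximalIdeal A)
    (hw : ∀ z ∈ maximalIdeal A, ∃ u : A, IsUnit u ∧ ∃ Q : ℤ[X], u * z = aeval w Q)
    (F : ℤ[X]) (hF : aeval w F = 0) (hF' : aeval w (derivative F) ∉ maximalIdeal A) :
    (maximalIdeal A).IsPrincipal := by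
  obtain ⟨G, hG, hdiv⟩ := exists_maximalIdeal_eq_span_pair w hp hw
  obtain ⟨H, R, rfl⟩ := hdiv F (hF ▸ zero_mem _)
  have hGm : aeval w G ∈ maximalIdeal A := hG ▸ Ideal.subset_span (by simp)
  -- With `F = G * H + p * R`, if `H(w)` were in `𝔪`, each term of `F'(w)` would be too. Once `H(w)`
  -- is a unit, `F(w) = 0` gives `G(w) ∈ (p)`.
  have hH : IsUnit (aeval w H) := by
    by_contra h
    have hHm : aeval w H ∈ maximalIdeal A := h
    apply hF'
    simp only [derivative_mul, map_add, map_mul, map_natCast, derivative_natCast,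
      zero_mul, zero_add]
    exact add_mem (add_mem (Ideal.mul_mem_left _ _ hHm) (Ideal.mul_mem_right _ _ hGm))
      (Ideal.mul_mem_right _ _ hp)
  refine ⟨(p : A), ?_⟩
  rw [hG]
  refine le_antisymm ?_ (Ideal.span_mono (by simp))
  rw [Ideal.span_le]
  rintro _ (rfl | rfl)
  · exact Ideal.mem_span_singleton_self _
  · rw [SetLike.mem_coe]
    change _ ∈ Ideal.span {(p : A)}
    rw [← Ideal.mul_unit_mem_iff_mem _ hH, Ideal.mem_span_singleton]
    simp only [map_add, map_mul, map_natCast] at hF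
    exact ⟨-aeval w R, by linear_combination hF⟩

/-- In `𝔪 = (p, G(w))` the generator `p` is redundant modulo `𝔪 ^ 2`, hence redundant by Nakayama.
-/
theorem maximalIdeal_isPrincipal_of_mem_sq {A : Type*} [CommRing A] [IsLocalRing A]
    [IsNoetherianRing A] {p : ℕ} [Fact p.Prime] (w : A) (hp : (p : A) ∈ maximalIdeal A ^ 2)
    (hw : ∀ z ∈ maximalIdeal A, ∃ u : A, IsUnit u ∧ ∃ Q : ℤ[X], u * z = aeval w Q) :
    (maximalIdeal A).IsPrincipal := by
  obtain ⟨G, hG, -⟩ := exists_maximalIdeal_eq_span_pair w (Ideal.pow_le_self two_ne_zero hp) hw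
  refine ⟨aeval w G, le_antisymm ?_ ?_⟩
  · apply Submodule.le_of_le_smul_of_le_jacobson_bot (I := maximalIdeal A)
      (IsNoetherian.noetherian (maximalIdeal A)) (IsLocalRing.maximalIdeal_le_jacobson _)
    rw [smul_eq_mul, ← pow_two]
    nth_rewrite 1 [hG]
    rw [Ideal.span_le]
    rintro _ (rfl | rfl)
    · exact Ideal.mem_sup_right hp
    · exact Ideal.mem_sup_left (Ideal.mem_span_singleton_self _)
  · rw [Submodule.span_singleton_le_iff_mem, hG]
    exact Ideal.subset_span (by simp)

theorem isUnit_intCast_of_not_dvd {A : Type*} [CommRing A] [IsLocalRing A] {p : ℕ}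
    [Fact p.Prime] (hp : (p : A) ∈ maximalIdeal A) {n : ℤ} (hn : ¬ (p : ℤ) ∣ n) :
    IsUnit (n : A) := by
  by_contra h
  have hm : (n : A) ∈ maximalIdeal A := h
  obtain ⟨u, v, huv⟩ := ((Nat.prime_iff_prime_int.1 Fact.out).coprime_iff_not_dvd.2 hn :
    IsCoprime (p : ℤ) n)
  apply (maximalIdeal A).one_notMem
  have : (u : A) * (p : A) + v * n = 1 := by exact_mod_cast congrArg (Int.cast (R := A)) huv
  rw [← this]
  exact add_mem (Ideal.mul_mem_left _ _ hp) (Ideal.mul_mem_left _ _ hm)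

/-- If `p` divides `n` at most once and `n` times a unit lies in `𝔪 ^ 2`, then `p ∈ 𝔪 ^ 2`. -/
theorem natCast_mem_maximalIdeal_sq {A : Type*} [CommRing A] [IsLocalRing A] {p : ℕ}
    [Fact p.Prime] (hp : (p : A) ∈ maximalIdeal A) {n : ℤ} (hn : ¬ (p : ℤ) ^ 2 ∣ n)
    (h : (n : A) ∈ maximalIdeal A ^ 2) : (p : A) ∈ maximalIdeal A ^ 2 := by
  by_cases hd : (p : ℤ) ∣ n
  · obtain ⟨c, rfl⟩ := hd
    have hc : IsUnit (c : A) := isUnit_intCast_of_not_dvd hp fun ⟨e, he⟩ =>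
      hn ⟨e, by rw [he]; ring⟩
    rw [← Ideal.mul_unit_mem_iff_mem _ hc]
    exact_mod_cast h
  · exact absurd (isUnit_intCast_of_not_dvd hp hd) (Ideal.pow_le_self two_ne_zero h)

end LocalRing

/-! ### The local analysis at each prime. -/

section LocalChebyshev

open IsLocalRing

/-- Clears denominators in `P(c / b)`. As `N` and `k` do not depend on `A`, one integer can be read
in `ℚ`, in `ZMod p` and in the local ring. -/
theorem exists_intCast_eq_pow_mul_aeval (b c : ℤ) (P : ℤ[X]) :
    ∃ (N : ℤ) (k : ℕ), ∀ (A : Type) [CommRing A] (t : A), (b : A) * t = c →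
      (b : A) ^ k * aeval t P = N := by
  induction P using Polynomial.induction_on' with
  | add P Q hP hQ =>
    obtain ⟨N, k, h⟩ := hP
    obtain ⟨N', k', h'⟩ := hQ
    refine ⟨b ^ k' * N + b ^ k * N', k + k', fun A _ t ht => ?_⟩
    push_cast
    rw [← h A t ht, ← h' A t ht, map_add]
    ring
  | monomial n a =>
    refine ⟨a * c ^ n, n, fun A _ t ht => ?_⟩
    rw [aeval_monomial]
    push_cast
    rw [← ht, mul_pow, eq_intCast]
    ring

/-- Put `δ = γ - t`, where `t = T_p(γ)`. Comparing `T_p(γ)` with `T_p(t)` modulo `p * δ` shows that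
`T_p(t) - t + δ ^ p ∈ (p * δ)`. Since `T_p(t) - t` is `p` times a unit, `δ ∈ 𝔪` and `p` is a unit
times `δ ^ p`. -/
theorem natCast_mem_maximalIdeal_sq_of_eval_C_prime {A : Type} [CommRing A] [IsLocalRing A]
    {p : ℕ} [Fact p.Prime] (hp : (p : A) ∈ maximalIdeal A) {b : ℤ} (hb : b ≠ 0)
    (hpb : ¬ (p : ℤ) ∣ b)
    (hcongr : ¬ RatCongrModPow p 2
        ((Polynomial.Chebyshev.C ℚ (p : ℤ)).eval (2 + 1 / (b : ℚ))) (2 + 1 / (b : ℚ)))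
    (γ : A) (hγ : (b : A) * (Chebyshev.C A p).eval γ = 2 * b + 1) :
    (p : A) ∈ maximalIdeal A ^ 2 := by
  have hpp : p.Prime := Fact.out
  obtain ⟨N, k, hN⟩ := exists_intCast_eq_pow_mul_aeval b (2 * b + 1) (Chebyshev.C ℤ p - X)
  have hbA : IsUnit (b : A) := isUnit_intCast_of_not_dvd hp hpb
  obtain ⟨s, hs⟩ := Chebyshev.exists_C_prime_eq p
  have hpN : (p : ℤ) ∣ N := by
    have hbz : (b : ZMod p) ≠ 0 := by rwa [Ne, ZMod.intCast_zmod_eq_zero_iff_dvd]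
    have h := hN (ZMod p) ((b : ZMod p)⁻¹ * (2 * b + 1)) (by
      push_cast; field_simp)
    rw [← ZMod.intCast_zmod_eq_zero_iff_dvd, ← h, hs]
    simp [ZMod.pow_card]
  have hpN2 : ¬ (p : ℤ) ^ 2 ∣ N := by
    rintro ⟨n, rfl⟩
    have hbq : (b : ℚ) ≠ 0 := by exact_mod_cast hb
    have h := hN ℚ (2 + 1 / (b : ℚ)) (by push_cast; field_simp)
    refine hcongr ⟨(n : ℚ) / ((b ^ k : ℤ) : ℚ), fun hd => hpb ?_, ?_⟩
    · rw [← Rat.divInt_eq_div] at hd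
      exact (Nat.prime_iff_prime_int.1 hpp).dvd_of_dvd_pow
        ((Int.natCast_dvd_natCast.2 hd).trans (Rat.den_dvd n (b ^ k)))
    · rw [map_sub, Chebyshev.aeval_C, aeval_X] at h
      push_cast at h ⊢
      field_simp
      field_simp at h
      linear_combination h
  obtain ⟨n, rfl⟩ := hpN
  have hn : IsUnit (n : A) := isUnit_intCast_of_not_dvd hp fun ⟨e, he⟩ =>
    hpN2 ⟨e, by rw [he]; ring⟩
  set t : A := (Chebyshev.C A p).eval γ with ht
  have hNt := hN A t (by rw [hγ]; push_cast; ring)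
  obtain ⟨δ, hγδ⟩ : ∃ δ, δ = γ - t := ⟨_, rfl⟩
  obtain ⟨r, hr⟩ := exists_add_pow_prime_eq hpp δ t
  rw [hγδ, sub_add_cancel, ← hγδ] at hr
  obtain ⟨q, hq⟩ : δ ∣ aeval γ s - aeval t s := by
    have := sub_dvd_eval_sub γ t (s.map (algebraMap ℤ A))
    simpa only [← hγδ, eval_map_algebraMap] using this
  have h1 : t = γ ^ p + p * aeval γ s := by
    have := congrArg (aeval γ) hs
    rw [Chebyshev.aeval_C, ← ht] at this
    simpa using this
  have h2 : aeval t (Chebyshev.C ℤ p - X) = t ^ p + p * aeval t s - t := by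
    rw [hs]; simp
  rw [h2] at hNt
  push_cast at hNt
  have key : (p : A) * (n + (b : A) ^ k * δ * (t * r + q)) = -((b : A) ^ k * δ ^ p) := by
    linear_combination -hNt - (b : A) ^ k * h1 - (b : A) ^ k * hr - (b : A) ^ k * p * hq
  have hδ : δ ∈ maximalIdeal A := by
    have h : (b : A) ^ k * δ ^ p ∈ maximalIdeal A := by
      rw [← neg_mem_iff, ← key]; exact Ideal.mul_mem_right _ _ hp
    rw [Ideal.unit_mul_mem_iff_mem _ (hbA.pow k)] at h
    exact Ideal.IsPrime.mem_of_pow_mem inferInstance _ h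
  have hu : IsUnit (n + (b : A) ^ k * δ * (t * r + q)) := by
    by_contra h
    have hm : n + (b : A) ^ k * δ * (t * r + q) ∈ maximalIdeal A := h
    refine absurd hn ?_
    change (n : A) ∈ maximalIdeal A
    exact (Ideal.add_mem_iff_left _
      (Ideal.mul_mem_right _ _ (Ideal.mul_mem_left _ _ hδ))).1 hm
  rw [← Ideal.mul_unit_mem_iff_mem _ hu, key, neg_mem_iff]
  exact Ideal.mul_mem_left _ _
    (Ideal.pow_le_pow_right hpp.two_le (Ideal.pow_mem_pow hδ p))

/-- Regularity of `ℤ[α]` above a prime `p ∤ b`. -/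
theorem maximalIdeal_isPrincipal_of_eval_C {A : Type} [CommRing A] [IsLocalRing A]
    [IsNoetherianRing A] {p : ℕ} [Fact p.Prime] (hp : (p : A) ∈ maximalIdeal A) {d b : ℤ}
    (hb : b ≠ 0) (hpb : ¬ (p : ℤ) ∣ b) (hsq : Squarefree (1 + 4 * b))
    (hcongr : (p : ℤ) ∣ d → ¬ RatCongrModPow p 2
        ((Polynomial.Chebyshev.C ℚ (p : ℤ)).eval (2 + 1 / (b : ℚ))) (2 + 1 / (b : ℚ)))
    (a : A) (ha : (b : A) * (Chebyshev.C A d).eval a = 2 * b + 1)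
    (hgen : ∀ z ∈ maximalIdeal A, ∃ u : A, IsUnit u ∧ ∃ Q : ℤ[X], u * z = aeval a Q) :
    (maximalIdeal A).IsPrincipal := by
  have hbA : IsUnit (b : A) := isUnit_intCast_of_not_dvd hp hpb
  by_cases hd : (p : ℤ) ∣ d
  · obtain ⟨e, rfl⟩ := hd
    rw [Chebyshev.C_mul, eval_comp] at ha
    exact maximalIdeal_isPrincipal_of_mem_sq a
      (natCast_mem_maximalIdeal_sq_of_eval_C_prime hp hb hpb (hcongr (dvd_mul_right _ _)) _ ha)
      hgen
  · by_cases hF : (derivative (Chebyshev.C A d)).eval a ∈ maximalIdeal A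
    · refine maximalIdeal_isPrincipal_of_mem_sq a (natCast_mem_maximalIdeal_sq hp
        (n := 1 + 4 * b) (fun h => ?_) ?_) hgen
      · have := hsq p (by rwa [← pow_two])
        exact (Nat.prime_iff_prime_int.1 (Fact.out : p.Prime)).not_isUnit this
      · have hdA : IsUnit (d : A) := isUnit_intCast_of_not_dvd hp hd
        have h := congrArg (eval a) (Chebyshev.X_sq_sub_four_mul_derivative_C_sq A d)
        simp only [eval_mul, eval_sub, eval_pow, eval_X, eval_ofNat, eval_intCast] at h
        rw [← Ideal.unit_mul_mem_iff_mem _ (hdA.pow 2)]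
        -- From `b * T_d(a) = 2b + 1`: `b² (T_d(a)² - 4) = (2b + 1)² - 4b² = 1 + 4b`.
        have h2 : (d : A) ^ 2 * ((1 + 4 * b : ℤ) : A) =
            (b ^ 2 * (a ^ 2 - 4)) * eval a (derivative (Chebyshev.C A d)) ^ 2 := by
          push_cast
          linear_combination (-(b : A) ^ 2) * h - (d : A) ^ 2 *
            ((b : A) * (Chebyshev.C A d).eval a + 2 * b + 1) * ha
        rw [h2]
        exact Ideal.mul_mem_left _ _ (Ideal.pow_mem_pow hF 2)
    · refine maximalIdeal_isPrincipal_of_derivative_notMem a hp hgen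
        (Polynomial.C b * Chebyshev.C ℤ d - Polynomial.C (2 * b + 1)) ?_ ?_
      · simp only [map_sub, map_mul, Chebyshev.aeval_C, eq_intCast, map_intCast, ha]
        push_cast; ring
      · have h : derivative (Polynomial.C b * Chebyshev.C ℤ d - Polynomial.C (2 * b + 1)) =
            Polynomial.C b * derivative (Chebyshev.C ℤ d) := by
          simp only [derivative_sub, derivative_C_mul, derivative_C, sub_zero]
        rw [h, map_mul, aeval_C, eq_intCast, Ideal.unit_mul_mem_iff_mem _ hbA,
          ← eval_map_algebraMap, ← derivative_map, Chebyshev.map_C]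
        exact hF

theorem isUnit_aeval_of_coeff_zero_eq_one {A : Type*} [CommRing A] [IsLocalRing A] {y : A}
    (hy : y ∈ maximalIdeal A) {G : ℤ[X]} (hG : G.coeff 0 = 1) : IsUnit (aeval y G) := by
  by_contra h
  have hm : aeval y G ∈ maximalIdeal A := h
  apply (maximalIdeal A).one_notMem
  rw [← divX_mul_X_add G, hG] at hm
  simp only [map_add, map_mul, aeval_X, map_one] at hm
  exact (Ideal.add_mem_iff_right _ (Ideal.mul_mem_left _ _ hy)).1 hm

/-- Regularity of an Eisenstein extension above a prime `p` exactly dividing `b`. -/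
theorem maximalIdeal_isPrincipal_of_pow_eq {A : Type*} [CommRing A] [IsLocalRing A]
    [IsNoetherianRing A] {p : ℕ} [Fact p.Prime] (hp : (p : A) ∈ maximalIdeal A) {d : ℕ} {b : ℤ}
    (hsq : Squarefree b) (hpb : (p : ℤ) ∣ b) (hd : d ≠ 0) (y : A) (G : ℤ[X]) (hG0 : G.coeff 0 = 1)
    (hG : d = 1 → G = 1) (hy : y ^ d = b * aeval y G)
    (hgen : ∀ z ∈ maximalIdeal A, ∃ u : A, IsUnit u ∧ ∃ Q : ℤ[X], u * z = aeval y Q) :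
    (maximalIdeal A).IsPrincipal := by
  -- For `d = 1` the equation only puts `b` in `𝔪`, not in `𝔪 ^ 2`; but then `y = b` is a root of `X
  -- - b`, whose derivative is `1`.
  obtain rfl | h2 : d = 1 ∨ 2 ≤ d := by omega
  · refine maximalIdeal_isPrincipal_of_derivative_notMem y hp hgen (X - Polynomial.C b) ?_ ?_
    · rw [hG rfl] at hy
      simp at hy
      simp [hy]
    · simp
  · have hbm : (b : A) ∈ maximalIdeal A := by
      obtain ⟨c, rfl⟩ := hpb
      push_cast
      exact Ideal.mul_mem_right _ _ hp
    have hym : y ∈ maximalIdeal A := by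
      refine Ideal.IsPrime.mem_of_pow_mem inferInstance d ?_
      rw [hy]
      exact Ideal.mul_mem_right _ _ hbm
    have hu : IsUnit (aeval y G) := isUnit_aeval_of_coeff_zero_eq_one hym hG0
    refine maximalIdeal_isPrincipal_of_mem_sq y (natCast_mem_maximalIdeal_sq hp (n := b)
      (fun h => ?_) ?_) hgen
    · have := hsq p (by rwa [← pow_two])
      exact (Nat.prime_iff_prime_int.1 (Fact.out : p.Prime)).not_isUnit this
    · rw [← Ideal.mul_unit_mem_iff_mem _ hu, ← hy]
      exact Ideal.pow_le_pow_right h2 (Ideal.pow_mem_pow hym d)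

end LocalChebyshev

/-! ### From local principality to monogenicity. -/

section Criterion

open IsLocalRing

/-- By integrality a nonzero prime meets `ℤ` in a nonzero prime ideal, so it contains some prime
number and `hloc` makes its localization a DVR. -/
theorem isDedekindDomain_adjoin_singleton {K : Type*} [Field K] [CharZero K] {y : K}
    (hy : IsIntegral ℤ y)
    (hloc : ∀ (p : ℕ) [Fact p.Prime] (m : Ideal (Algebra.adjoin ℤ {y})) [m.IsPrime],
      (p : Algebra.adjoin ℤ {y}) ∈ m → (maximalIdeal (Localization.AtPrime m)).IsPrincipal) :
    IsDedekindDomain (Algebra.adjoin ℤ {y}) := by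
  have hN : IsNoetherianRing (Algebra.adjoin ℤ {y}) :=
    isNoetherianRing_of_fg (by simpa using Subalgebra.fg_adjoin_finset (R := ℤ) {y})
  have : IsDedekindDomainDvr (Algebra.adjoin ℤ {y}) :=
    { toIsNoetherian := hN
      is_dvr_at_nonzero_prime := by
        intro m hm0 hm
        obtain ⟨x, hxm, hx0⟩ := Submodule.exists_mem_ne_zero_of_ne_bot hm0
        have hxi : IsIntegral ℤ x :=
          (isIntegral_algHom_iff (Algebra.adjoin ℤ {y}).val Subtype.val_injective).1
            (adjoin_le_integralClosure hy x.2)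
        have hc := Ideal.comap_ne_bot_of_integral_mem hx0 hxm hxi
        obtain ⟨q, hq⟩ := (IsPrincipalIdealRing.principal
          (m.comap (algebraMap ℤ (Algebra.adjoin ℤ {y})))).principal
        have hq0 : q ≠ 0 := by
          rintro rfl
          exact hc (hq.trans (by simp))
        have hqp : Prime q := by
          rw [← Ideal.span_singleton_prime hq0]
          have h : (m.comap (algebraMap ℤ (Algebra.adjoin ℤ {y}))).IsPrime := inferInstance
          rwa [hq] at h
        have : Fact q.natAbs.Prime := ⟨Int.prime_iff_natAbs_prime.1 hqp⟩
        have hmem : (q.natAbs : Algebra.adjoin ℤ {y}) ∈ m := by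
          have h : (q.natAbs : ℤ) ∈ m.comap (algebraMap ℤ (Algebra.adjoin ℤ {y})) := by
            rw [hq]
            exact Ideal.mem_span_singleton.2 (Int.dvd_natAbs.2 dvd_rfl)
          rw [Ideal.mem_comap] at h
          simpa only [eq_intCast, Int.cast_natCast] using h
        exact ((IsDiscreteValuationRing.TFAE (Localization.AtPrime m)
          (IsLocalization.AtPrime.not_isField _ hm0 _)).out 0 4).2 (hloc q.natAbs m hmem) }
  infer_instance

theorem isFractionRing_adjoin_singleton {K : Type*} [Field K] [Algebra ℚ K] {y : K}
    (htop : IntermediateField.adjoin ℚ {y} = ⊤) :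
    IsFractionRing (Algebra.adjoin ℤ {y}) K := by
  have hint : ∀ r : ℚ[X], ∃ n : ℤ, n ≠ 0 ∧ (n : K) * aeval y r ∈ Algebra.adjoin ℤ {y} := by
    intro r
    obtain ⟨n, hn, h⟩ := IsLocalization.integerNormalization_spec (nonZeroDivisors ℤ) r
    refine ⟨n, nonZeroDivisors.ne_zero hn, ?_⟩
    rw [Algebra.adjoin_singleton_eq_range_aeval]
    refine ⟨IsLocalization.integerNormalization (nonZeroDivisors ℤ) r, ?_⟩
    have h2 := congrArg (aeval y) h
    rw [aeval_map_algebraMap, map_zsmul, zsmul_eq_mul] at h2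
    exact h2
  refine IsFractionRing.of_field _ K fun z => ?_
  have hz : z ∈ IntermediateField.adjoin ℚ {y} := htop ▸ IntermediateField.mem_top
  obtain ⟨r, s, rfl⟩ := (IntermediateField.mem_adjoin_simple_iff ℚ z).1 hz
  have := algebraRat.charZero K
  obtain ⟨n, hn, hr⟩ := hint r
  obtain ⟨k, hk, hs⟩ := hint s
  have hn' : (n : K) ≠ 0 := by exact_mod_cast hn
  have hk' : (k : K) ≠ 0 := by exact_mod_cast hk
  refine ⟨⟨k * (n * aeval y r), mul_mem (intCast_mem _ _) hr⟩,
    ⟨n * (k * aeval y s), mul_mem (intCast_mem _ _) hs⟩, ?_⟩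
  change _ = k * (n * aeval y r) / (n * (k * aeval y s))
  rw [← mul_assoc, ← mul_assoc, mul_comm (k : K) n, mul_div_mul_left _ _ (mul_ne_zero hn' hk')]

/-- A Dedekind domain is integrally closed, so `ℤ[y]`, with fraction field `K`, contains every
algebraic integer of `K`. -/
theorem isMonogenicField_of_isPrincipal_maximalIdeal {K : Type*} [Field K] [Algebra ℚ K] {y : K}
    (hy : IsIntegral ℤ y) (htop : IntermediateField.adjoin ℚ {y} = ⊤)
    (hloc : ∀ (p : ℕ) [Fact p.Prime] (m : Ideal (Algebra.adjoin ℤ {y})) [m.IsPrime],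
      (p : Algebra.adjoin ℤ {y}) ∈ m → (maximalIdeal (Localization.AtPrime m)).IsPrincipal) :
    IsMonogenicField K := by
  have := algebraRat.charZero K
  have := isDedekindDomain_adjoin_singleton hy hloc
  have := isFractionRing_adjoin_singleton htop
  obtain ⟨β, hβ⟩ : ∃ β : NumberField.RingOfIntegers K, (β : K) = y := ⟨⟨y, hy⟩, rfl⟩
  refine ⟨β, eq_top_iff.2 fun x _ => ?_⟩
  obtain ⟨⟨z, hz⟩, hzx⟩ := IsIntegrallyClosed.isIntegral_iff.1
    (IsIntegral.tower_top (A := Algebra.adjoin ℤ {y}) x.isIntegral_coe)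
  change z = (x : K) at hzx
  rw [Algebra.adjoin_singleton_eq_range_aeval] at hz ⊢
  obtain ⟨Q, rfl⟩ := hz
  refine ⟨Q, NumberField.RingOfIntegers.ext ?_⟩
  rw [← hzx]
  change algebraMap (NumberField.RingOfIntegers K) K (aeval β Q) = aeval y Q
  rw [← aeval_algebraMap_apply]
  exact congrArg (fun x => aeval x Q) hβ

end Criterion

/-! ### The order `ℤ[y]`, and reality of the roots. -/

section ChebyshevField

open IsLocalRing

/-- `G` is the reversal of `(T_{n+1}(X + 2) - 2) / X`, a polynomial because `T_{n+1}(2) = 2`; its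
constant term is the leading coefficient `1`. The identity is needed both in `K` and in the
localizations. -/
theorem exists_polynomial_pow_mul_aeval_eq_eval_C_sub_two (n : ℕ) :
    ∃ G : ℤ[X], G.natDegree ≤ n ∧ G.coeff 0 = 1 ∧ (n = 0 → G = 1) ∧
      ∀ (R : Type) [CommRing R] (y w : R), y * w = 1 →
        w ^ (n + 1) * aeval y G = (Chebyshev.C R (n + 1 : ℕ)).eval (w + 2) - 2 := by
  obtain ⟨hm, hdeg⟩ := Chebyshev.monic_C_natDegree_C ℤ n
  set P : ℤ[X] := (Chebyshev.C ℤ (n + 1 : ℕ)).comp (X + C 2) - C 2 with hP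
  have hcm := hm.comp_X_add_C 2
  have hcd : ((Chebyshev.C ℤ (n + 1 : ℕ)).comp (X + C 2)).natDegree = n + 1 := by
    rw [natDegree_comp, hdeg, natDegree_X_add_C, mul_one]
  have hPd : P.natDegree = n + 1 := by rw [hP, natDegree_sub_C, hcd]
  have hPm : P.Monic := hcm.sub_of_left (degree_lt_degree (by rw [natDegree_C, hcd]; omega))
  have hP0 : P.coeff 0 = 0 := by
    rw [coeff_zero_eq_eval_zero, hP]
    simp
  have hPX : P.divX * X = P := by
    conv_rhs => rw [← divX_mul_X_add P, hP0, C_0, add_zero]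
  have hDd : P.divX.natDegree = n := by rw [natDegree_divX_eq_natDegree_tsub_one, hPd]; rfl
  have hDn : P.divX.coeff n = 1 := by rw [coeff_divX, ← hPd]; exact hPm
  refine ⟨reflect n P.divX, ?_, ?_, ?_, ?_⟩
  · exact natDegree_reflect_le.trans (by simp [hDd])
  · rw [coeff_reflect, revAt_le (Nat.zero_le _)]
    simpa using hDn
  · rintro rfl
    have h : P.divX = 1 := by rw [eq_C_of_natDegree_eq_zero hDd, hDn, C_1]
    rw [h, reflect_one, pow_zero]
  · intro R _ y w hyw
    let _ : Invertible w := ⟨y, hyw, by rw [mul_comm, hyw]⟩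
    have h := eval₂_reflect_mul_pow (algebraMap ℤ R) w n P.divX hDd.le
    have h2 := congrArg (aeval w) hPX
    rw [hP, map_sub, aeval_comp, Chebyshev.aeval_C, map_mul, ← hP] at h2
    simp only [map_add, aeval_X, map_ofNat] at h2
    rw [← h2, pow_succ, mul_right_comm, aeval_def, aeval_def, ← h, mul_comm (w ^ n)]
    rfl

/-- Regularity at `p` of an order `ℤ[y]`, where `y = (α - 2)⁻¹` and `T_{n + 1}(α) = 2 + 1 / b`. -/
theorem maximalIdeal_isPrincipal_localization {O : Type} [CommRing O] [IsNoetherianRing O]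
    [Algebra ℤ O] (m : Ideal O) [m.IsPrime] (A : Type) [CommRing A] [IsLocalRing A] [Algebra O A]
    [IsLocalization.AtPrime A m] {p : ℕ} [Fact p.Prime] (hpm : (p : O) ∈ m) (n : ℕ) {b : ℤ}
    (hb : b ≠ 0) (hsq : Squarefree b) (hsq' : Squarefree (1 + 4 * b))
    (hcongr : (p : ℤ) ∣ (n + 1 : ℕ) → ¬ (p : ℤ) ∣ b →
      ¬ RatCongrModPow p 2
        ((Polynomial.Chebyshev.C ℚ (p : ℤ)).eval (2 + 1 / (b : ℚ))) (2 + 1 / (b : ℚ)))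
    (y : O) (hO : ∀ x : O, ∃ Q : ℤ[X], aeval y Q = x)
    (G : ℤ[X]) (hG0 : G.coeff 0 = 1) (hG1 : n = 0 → G = 1)
    (hG : ∀ (R : Type) [CommRing R] (y w : R), y * w = 1 →
        w ^ (n + 1) * aeval y G = (Chebyshev.C R (n + 1 : ℕ)).eval (w + 2) - 2)
    (hyG : y ^ (n + 1) = b * aeval y G) : (maximalIdeal A).IsPrincipal := by
  have : IsNoetherianRing A := IsLocalization.isNoetherianRing m.primeCompl A inferInstance
  set yA : A := algebraMap O A y with hyA
  have hφ : ∀ Q : ℤ[X], algebraMap O A (aeval y Q) = aeval yA Q := fun Q => by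
    rw [aeval_def, hom_eval₂, aeval_def]
    congr 1
    exact RingHom.ext_int _ _
  have hpA : (p : A) ∈ maximalIdeal A := by
    have := (IsLocalization.AtPrime.to_map_mem_maximal_iff A m (p : O)).2 hpm
    simpa using this
  have hyGA : yA ^ (n + 1) = b * aeval yA G := by
    have h2 := congrArg (algebraMap O A) hyG
    rwa [map_pow, map_mul, map_intCast, hφ] at h2
  have hgen : ∀ z : A, ∃ u : A, IsUnit u ∧ ∃ Q : ℤ[X], u * z = aeval yA Q := by
    intro z
    obtain ⟨x, s, rfl⟩ := IsLocalization.exists_mk'_eq m.primeCompl z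
    refine ⟨algebraMap O A s, IsLocalization.map_units A s, ?_⟩
    obtain ⟨Q, rfl⟩ := hO x
    exact ⟨Q, by rw [IsLocalization.mk'_spec', hφ]⟩
  by_cases hpb : (p : ℤ) ∣ b
  · exact maximalIdeal_isPrincipal_of_pow_eq hpA hsq hpb n.succ_ne_zero yA G hG0
      (fun h => hG1 (by omega)) hyGA fun z _ => hgen z
  -- If `y ∈ 𝔪`, then `G(y)` is a unit since `G(0) = 1`, and so is `b`, contradicting `y ^ (n + 1) =
  -- b * G(y)`.
  · have hyu : IsUnit yA := by
      by_contra h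
      have hym : yA ∈ maximalIdeal A := h
      have hbG : (b : A) * aeval yA G ∈ maximalIdeal A := by
        rw [← hyGA, pow_succ]
        exact Ideal.mul_mem_left _ _ hym
      rw [Ideal.unit_mul_mem_iff_mem _ (isUnit_intCast_of_not_dvd hpA hpb)] at hbG
      exact hbG (isUnit_aeval_of_coeff_zero_eq_one hym hG0)
    obtain ⟨w, hyw'⟩ := hyu.exists_right_inv
    refine maximalIdeal_isPrincipal_of_eval_C hpA hb hpb hsq'
      (fun h => hcongr h hpb) (w + 2) ?_ fun z _ => ?_
    · have h := hG A yA w hyw'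
      have h3 : (yA * w) ^ (n + 1) = 1 := by rw [hyw', one_pow]
      rw [mul_pow] at h3
      linear_combination (-(b : A)) * h - w ^ (n + 1) * hyGA + h3
    · obtain ⟨u, hu, Q, hQ⟩ := hgen z
      let _ : Invertible yA := ⟨w, by rw [mul_comm, hyw'], hyw'⟩
      have h := eval₂_reflect_mul_pow (algebraMap ℤ A) yA Q.natDegree Q le_rfl
      have hwu : IsUnit w := IsUnit.of_mul_eq_one yA (by rw [mul_comm, hyw'])
      -- Multiplying by a power of `w = y⁻¹` turns a polynomial in `y` into its reversal in `w`,
      -- hence into a polynomial in `w + 2`.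
      refine ⟨w ^ Q.natDegree * u, (hwu.pow _).mul hu,
        (reflect Q.natDegree Q).comp (X - C 2), ?_⟩
      have h3 : (yA * w) ^ Q.natDegree = 1 := by rw [hyw', one_pow]
      rw [mul_pow] at h3
      rw [aeval_comp]
      simp only [map_sub, aeval_X, map_ofNat, add_sub_cancel_right]
      change eval₂ (algebraMap ℤ A) w _ * _ = _ at h
      rw [mul_assoc, hQ, aeval_def, aeval_def, ← h, mul_left_comm, mul_comm (w ^ _), h3, mul_one]

theorem isMonogenicField_of_eval_C_eq {K : Type} [Field K] [Algebra ℚ K] (n : ℕ) {b : ℤ}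
    (hb : b ≠ 0) (hsq : Squarefree b) (hsq' : Squarefree (1 + 4 * b))
    (hcongr : ∀ p : ℕ, p.Prime → (p : ℤ) ∣ (n + 1 : ℕ) → ¬ (p : ℤ) ∣ b →
      ¬ RatCongrModPow p 2
        ((Polynomial.Chebyshev.C ℚ (p : ℤ)).eval (2 + 1 / (b : ℚ))) (2 + 1 / (b : ℚ)))
    (α : K) (htop : IntermediateField.adjoin ℚ {α} = ⊤)
    (hα : (Chebyshev.C K (n + 1 : ℕ)).eval α = 2 + 1 / (b : K)) :
    IsMonogenicField K := by
  have := algebraRat.charZero K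
  have hbK : (b : K) ≠ 0 := by exact_mod_cast hb
  obtain ⟨G, hGd, hG0, hG1, hG⟩ := exists_polynomial_pow_mul_aeval_eq_eval_C_sub_two n
  have hw : α - 2 ≠ 0 := by
    intro h
    rw [sub_eq_zero.1 h, Chebyshev.C_eval_two] at hα
    simp [hbK] at hα
  obtain ⟨y, hyw⟩ : ∃ y, y * (α - 2) = 1 := ⟨(α - 2)⁻¹, inv_mul_cancel₀ hw⟩
  have hyG : y ^ (n + 1) = b * aeval y G := by
    have h := hG K y (α - 2) hyw
    rw [sub_add_cancel, hα, add_sub_cancel_left, eq_div_iff hbK] at h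
    have h3 : (y * (α - 2)) ^ (n + 1) = 1 := by rw [hyw, one_pow]
    rw [mul_pow] at h3
    linear_combination (-y ^ (n + 1)) * h + b * aeval y G * h3
  have hyint : IsIntegral ℤ y := by
    refine ⟨X ^ (n + 1) - C b * G, monic_X_pow_sub ?_, ?_⟩
    · exact (degree_le_of_natDegree_le ((natDegree_C_mul_le b G).trans hGd)).trans_lt
        (by exact_mod_cast n.lt_succ_self)
    · rw [← aeval_def]
      simp [hyG]
  have hytop : IntermediateField.adjoin ℚ {y} = ⊤ := by
    rw [eq_top_iff, ← htop, IntermediateField.adjoin_simple_le_iff]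
    have : α = y⁻¹ + 2 := by rw [eq_inv_of_mul_eq_one_left hyw, inv_inv]; ring
    rw [this]
    exact add_mem (inv_mem (IntermediateField.mem_adjoin_simple_self ℚ y)) (ofNat_mem _ 2)
  refine isMonogenicField_of_isPrincipal_maximalIdeal hyint hytop fun p _ m _ hpm => ?_
  have : IsNoetherianRing (Algebra.adjoin ℤ {y}) :=
    isNoetherianRing_of_fg (by simpa using Subalgebra.fg_adjoin_finset (R := ℤ) {y})
  refine maximalIdeal_isPrincipal_localization m _ hpm n hb hsq hsq' (hcongr p Fact.out)
    ⟨y, Algebra.self_mem_adjoin_singleton ℤ y⟩ (fun x => ?_) G hG0 hG1 hG ?_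
  · obtain ⟨Q, hQ⟩ := (Algebra.adjoin_singleton_eq_range_aeval ℤ y).le x.2
    exact ⟨Q, Subtype.val_injective
      ((aeval_algHom_apply (Algebra.adjoin ℤ {y}).val _ Q).symm.trans hQ)⟩
  · apply Subtype.val_injective
    have h := aeval_algHom_apply (Algebra.adjoin ℤ {y}).val
      ⟨y, Algebra.self_mem_adjoin_singleton ℤ y⟩ G
    refine hyG.trans ?_
    rw [MulMemClass.coe_mul]
    exact congrArg₂ _ (by simp) h

/-- The solutions of `T_d(z) = t` with `t ∈ [-2, 2]` are real. -/
theorem conj_eq_of_eval_C_eq {d : ℤ} (hd : d ≠ 0) {t : ℝ} (h1 : -2 ≤ t) (h2 : t ≤ 2) {z : ℂ}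
    (hz : (Chebyshev.C ℂ d).eval z = t) : (starRingEnd ℂ) z = z := by
  -- A priori `θ` is complex; `cos (d * θ) = t / 2` is the cosine of a real angle, which forces `d *
  -- θ`, hence `θ`, to be real.
  obtain ⟨θ, hθ⟩ := Complex.cos_surjective (z / 2)
  have hzθ : z = 2 * Complex.cos θ := by rw [hθ]; ring
  rw [hzθ, Chebyshev.C_two_mul_complex_cos] at hz
  have hc : Complex.cos (d * θ) = Complex.cos (Real.arccos (t / 2) : ℝ) := by
    rw [← Complex.ofReal_cos, Real.cos_arccos (by linarith) (by linarith)]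
    push_cast
    linear_combination hz / 2
  have hdC : (d : ℂ) ≠ 0 := by exact_mod_cast hd
  obtain ⟨r, rfl⟩ : ∃ r : ℝ, θ = r := by
    obtain ⟨k, hk | hk⟩ := Complex.cos_eq_cos_iff.1 hc
    · refine ⟨(Real.arccos (t / 2) - 2 * k * Real.pi) / d, ?_⟩
      push_cast
      rw [eq_div_iff hdC]
      linear_combination -hk
    · refine ⟨(2 * k * Real.pi - Real.arccos (t / 2)) / d, ?_⟩
      push_cast
      rw [eq_div_iff hdC]
      linear_combination hk
  rw [hzθ, ← Complex.ofReal_cos, map_mul, Complex.conj_ofReal, map_ofNat]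

end ChebyshevField

/-- For `d` and `b` as below, a root `α` of `T_d - (2 + 1 / b)` generates a totally real monogenic
field, with `(α - 2)⁻¹` as generator of the ring of integers. -/
theorem theorem4p10 (d b : ℤ) (hb : b < -1)
    (hsq : Squarefree b) (hsq' : Squarefree (1 + 4 * b))
    (hcongr : ∀ p : ℕ, p.Prime → (p : ℤ) ∣ d → ¬ (p : ℤ) ∣ b →
      ¬ RatCongrModPow p 2
        ((Polynomial.Chebyshev.C ℚ (p : ℤ)).eval (2 + 1 / (b : ℚ))) (2 + 1 / (b : ℚ)))
    (α : ℂ)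
    (hα : Polynomial.aeval α
      (Polynomial.Chebyshev.C ℚ d - Polynomial.C (2 + 1 / (b : ℚ))) = 0) :
    NumberField (IntermediateField.adjoin ℚ {α}) ∧
    IsMonogenicField (IntermediateField.adjoin ℚ {α}) ∧
    NumberField.IsTotallyReal (IntermediateField.adjoin ℚ {α}) := by
  have hb0 : b ≠ 0 := by omega
  rw [map_sub, Chebyshev.aeval_C, aeval_C, sub_eq_zero, eq_ratCast] at hα
  push_cast at hα
  have hd : d ≠ 0 := by
    rintro rfl
    have hbC : (b : ℂ) ≠ 0 := by exact_mod_cast hb0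
    simp [hbC] at hα
  obtain ⟨n, hn⟩ : ∃ n, d.natAbs = n + 1 := Nat.exists_eq_succ_of_ne_zero (by omega)
  have hint : IsIntegral ℚ α := by
    refine IsIntegral.of_aeval_monic (Chebyshev.monic_C_natDegree_C ℚ n).1
      (by rw [(Chebyshev.monic_C_natDegree_C ℚ n).2]; omega) ?_
    rw [Chebyshev.aeval_C, ← hn, Chebyshev.C_natAbs, hα]
    have h := isIntegral_algebraMap (R := ℚ) (A := ℂ) (x := 2 + 1 / (b : ℚ))
    simpa using h
  have : FiniteDimensional ℚ (IntermediateField.adjoin ℚ {α}) :=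
    IntermediateField.adjoin.finiteDimensional hint
  have htop : IntermediateField.adjoin ℚ {IntermediateField.AdjoinSimple.gen ℚ α} = ⊤ := by
    have := (IntermediateField.adjoin.powerBasis hint).adjoin_gen_eq_top
    rw [IntermediateField.adjoin.powerBasis_gen] at this
    exact IntermediateField.adjoin_eq_top_of_algebra _ _ this
  have hgen : (Chebyshev.C (IntermediateField.adjoin ℚ {α}) d).eval
      (IntermediateField.AdjoinSimple.gen ℚ α) = 2 + 1 / (b : IntermediateField.adjoin ℚ {α}) := by
    apply (algebraMap (IntermediateField.adjoin ℚ {α}) ℂ).injective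
    rw [Chebyshev.algebraMap_eval_C, IntermediateField.AdjoinSimple.algebraMap_gen, hα, map_add, map_ofNat]
    simp
  refine ⟨{}, ?_, ⟨fun v => ?_⟩⟩
  · refine isMonogenicField_of_eval_C_eq n hb0 hsq hsq' (fun p hp hpd => hcongr p hp ?_) _ htop ?_
    · rwa [← hn, Int.dvd_natAbs] at hpd
    · rwa [← hn, Chebyshev.C_natAbs]
  · rw [NumberField.InfinitePlace.isReal_iff]
    set φ := v.embedding
    -- Every embedding sends the generator to another root of `T_d(z) = 2 + 1/b`, and `-1 ≤ 1/b ≤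
    -- 0`.
    have hφ : (starRingEnd ℂ) (φ (IntermediateField.AdjoinSimple.gen ℚ α)) =
        φ (IntermediateField.AdjoinSimple.gen ℚ α) := by
      have hbR : (b : ℝ) ≤ -2 := by exact_mod_cast (by omega : b ≤ -2)
      have h1 : (1 : ℝ) / b ≤ 0 := div_nonpos_of_nonneg_of_nonpos zero_le_one (by linarith)
      have h2 : -1 ≤ (1 : ℝ) / b := by rw [le_div_iff_of_neg (by linarith)]; linarith
      refine conj_eq_of_eval_C_eq hd (t := 2 + 1 / (b : ℝ)) (by linarith) (by linarith) ?_
      rw [← Chebyshev.map_C φ, eval_map_apply, hgen, map_add, map_ofNat]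
      simp
    have heq : (RingHom.toRatAlgHom ((starRingEnd ℂ).comp φ)) = RingHom.toRatAlgHom φ := by
      refine IntermediateField.adjoin_algHom_ext ℚ fun x hx => ?_
      obtain rfl := Set.mem_singleton_iff.1 hx
      exact hφ
    refine RingHom.ext fun x => ?_
    exact DFunLike.congr_fun heq x
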